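/- Let $n\ge 2$ and $\delta,\tau\in(0,\tfrac12)$. Let $G\subset O(n)$ be a Coxeter group, that is, a group generated by the reflections through $n$ independent linear hyperplanes, acting reducibly on $\mathbb R^n$ (some linear subspace other than $\{0\}$ and $\mathbb R^n$ is $G$-invariant) and without non-zero fixed points. For $X\subset S^{n-1}$ and $\varrho\ge 0$ put $\Psi(X,\varrho)=\{u\in S^{n-1}:\exists x\in X,\ \|x-u\|\le\varrho\}$. Let $\mu$ be a $G$-invariant Borel probability measure on $S^{n-1}$ such that, for every $i=1,\dots,n-1$ and every $G$-invariant linear subspace $L$ of $\mathbb R^n$ with $\dim L=i$, $$\mu\big(\Psi(L\cap S^{n-1},\delta)\big)<(1-\tau)\cdot\frac in .$$ Let $C\subset\mathbb R^n$ be a $G$-invariant convex body of volume $V(C)=1$, with support function $h_C(u)=\max_{x\in C}\langle u,x\rangle$. Let $R(C)$ be the minimal radius of a Euclidean ball containing $C$, let $r(C)$ be the radius of the largest Euclidean ball contained in $C$, and let $\widetilde B$ be the Euclidean ball centred at the origin with $V(\widetilde B)=1$. Then: (i) $\log h_C$ is $\mu$-integrable and $$\int_{S^{n-1}}\log h_C\,d\mu\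 \ge\ \log\frac{R(C)^{\tau}\,\delta}{n^5};$$ (ii) if $\int_{S^{n-1}}\log h_C\,d\mu\le\int_{S^{n-1}}\log h_{\widetilde B}\,d\mu$, then $$R(C)<\Big(\frac{n^6}{\delta}\Big)^{\frac1\tau}\qquad\text{and}\qquad r(C)>\frac{n^{\frac n2}}{5^n}\Big(\frac{\delta}{n^6}\Big)^{\frac{n-1}{\tau}} .$$ -/

import Mathlib

namespace CoxeterLog

noncomputable section

open MeasureTheory

/-- `ℝⁿ` with its Euclidean structure. -/
abbrev E (n : ℕ) : Type := EuclideanSpace ℝ (Fin n)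

/-- The unit sphere `S^{n-1}` of `ℝⁿ`, as a type. -/
abbrev Sph (n : ℕ) : Type := Metric.sphere (0 : E n) 1

/-- The orthogonal group `O(n)`. -/
abbrev O (n : ℕ) : Type := E n ≃ₗᵢ[ℝ] E n

/-- The reflection through the linear hyperplane orthogonal to `v`. -/
def hyperplaneReflection {n : ℕ} (v : E n) : O n :=
  (Submodule.span ℝ {v})ᗮ.reflection

/-- A Coxeter group: a subgroup of `O(n)` generated by the reflections through `n` independent
linear hyperplanes (that is, `n` hyperplanes with linearly independent normal vectors). -/
def IsCoxeterReflectionGroup {n : ℕ} (G : Subgroup (O n)) : Prop :=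
  ∃ v : Fin n → E n, LinearIndependent ℝ v ∧
    G = Subgroup.closure (Set.range fun i => hyperplaneReflection (v i))

/-- `G` acts on `ℝⁿ` without non-zero fixed points. -/
def NoNonzeroFixedPoint {n : ℕ} (G : Subgroup (O n)) : Prop :=
  ∀ x : E n, (∀ g ∈ G, g x = x) → x = 0

/-- The linear subspace `L` is invariant under `G`. -/
def InvariantSubspace {n : ℕ} (G : Subgroup (O n)) (L : Submodule ℝ (E n)) : Prop :=
  ∀ g ∈ G, ∀ x ∈ L, g x ∈ L

/-- The action of `G` on `ℝⁿ` is reducible: there is an invariant linear subspace other than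
`{0}` and `ℝⁿ`. -/
def ActsReducibly {n : ℕ} (G : Subgroup (O n)) : Prop :=
  ∃ L : Submodule ℝ (E n), InvariantSubspace G L ∧ L ≠ ⊥ ∧ L ≠ ⊤

/-- The set `C` is invariant under `G`. -/
def InvariantSet {n : ℕ} (G : Subgroup (O n)) (C : Set (E n)) : Prop :=
  ∀ g ∈ G, g '' C = C

/-- The map induced on the sphere by an orthogonal transformation. -/
def sphereMap {n : ℕ} (g : O n) (u : Sph n) : Sph n :=
  ⟨g u, by simp⟩

/-- The measure `μ` on the sphere is invariant under `G`. -/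
def InvariantMeasure {n : ℕ} (G : Subgroup (O n)) (μ : Measure (Sph n)) : Prop :=
  ∀ g ∈ G, MeasurePreserving (sphereMap g) μ μ

/-- The tube `Ψ(X, ρ) = {u ∈ S^{n-1} : ∃ x ∈ X, ‖x - u‖ ≤ ρ}` around `X ⊆ S^{n-1}`. -/
def tube {n : ℕ} (X : Set (Sph n)) (ρ : ℝ) : Set (Sph n) :=
  {u | ∃ x ∈ X, ‖(x : E n) - (u : E n)‖ ≤ ρ}

/-- `L ∩ S^{n-1}`, as a subset of the sphere. -/
def sphereSection {n : ℕ} (L : Submodule ℝ (E n)) : Set (Sph n) :=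
  {u | (u : E n) ∈ L}

/-- The support function `h_C(u) = max {⟨u, x⟩ : x ∈ C}` (the supremum is a maximum for
non-empty compact `C`). -/
def supportFunction {n : ℕ} (C : Set (E n)) (u : E n) : ℝ :=
  sSup ((fun x => inner ℝ u x) '' C)

/-- `R(C)`: the minimal radius of a Euclidean ball (with any centre) containing `C`. -/
def circumradius {n : ℕ} (C : Set (E n)) : ℝ :=
  sInf {R : ℝ | 0 ≤ R ∧ ∃ x : E n, C ⊆ Metric.closedBall x R}

/-- `r(C)`: the radius of the largest Euclidean ball (with any centre) contained in `C`. -/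
def inradius {n : ℕ} (C : Set (E n)) : ℝ :=
  sSup {r : ℝ | 0 ≤ r ∧ ∃ x : E n, Metric.closedBall x r ⊆ C}

/-- The Euclidean ball centred at the origin of volume one; its radius is
`κₙ ^ (-1/n)` with `κₙ` the volume of the unit ball. -/
def unitVolumeBall (n : ℕ) : Set (E n) :=
  Metric.closedBall 0 ((volume.real (Metric.ball (0 : E n) 1)) ^ (-(1 : ℝ) / n))

theorem volume_unitVolumeBall {n : ℕ} (hn : 1 ≤ n) : volume (unitVolumeBall n) = 1 := by
  have hfin : volume (Metric.ball (0 : E n) 1) ≠ ⊤ := measure_ball_lt_top.ne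
  have hpos : 0 < volume.real (Metric.ball (0 : E n) 1) :=
    ENNReal.toReal_pos (Metric.measure_ball_pos volume _ one_pos).ne' hfin
  have hn' : (n : ℝ) ≠ 0 := by positivity
  have h1 : ((volume.real (Metric.ball (0 : E n) 1)) ^ (-(1 : ℝ) / n)) ^ n
      = (volume.real (Metric.ball (0 : E n) 1))⁻¹ := by
    rw [← Real.rpow_natCast, ← Real.rpow_mul hpos.le, div_mul_cancel₀ _ hn', Real.rpow_neg_one]
  rw [unitVolumeBall, Measure.addHaar_closedBall _ _ (by positivity), finrank_euclideanSpace_fin,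
    h1, ENNReal.ofReal_inv_of_pos hpos, Measure.real, ENNReal.ofReal_toReal hfin]
  exact ENNReal.inv_mul_cancel (Metric.measure_ball_pos volume _ one_pos).ne' hfin

end

end CoxeterLog

open CoxeterLog MeasureTheory

/-! The body is replaced by a `G`-invariant ellipsoid, for which the integral is an Abel summation.
Among all convex combinations of the matrices `(x,1)(x,1)ᵀ` with `x ∈ C`, take the one of largest
determinant (a D-optimal design). It is unique, hence `G`-invariant, and its barycentre is a fixed
point of `G`, hence `0`. Its second moment matrix `M` commutes with `G`, and optimality traps `C`
between two multiples, of ratio `n`, of the ellipsoid with squared support function `u ⬝ᵥ M *ᵥ u`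
(`exists_john_matrix`).

Let `r 0 ≥ … ≥ r m` be the semi-axes, `n = m + 1`. Wherever `r` drops strictly, the span of the
remaining shorter axes is a sum of eigenspaces of `M`, so it is invariant and the tube hypothesis
applies. If `k` is the first index for which `u` avoids the tube around the span of the axes after
`k`, then `h_C(u)` is at least a constant times `δ * r k`. Integrating the logarithm and summing by
parts gives `τ log (r 0) + (1 - τ) · mean (log r)` up to a constant
(`le_integral_log_of_ellipsoid_le`).

Volume one bounds the mean below, since `C` lies in a box with half-sides `√n * r i`, and `r 0` is
comparable to `R(C)`: this is (i). For (ii), the unit-volume ball has radius at most `n`, which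
bounds `R(C)`; the bound on the product of the semi-axes then keeps the shortest one, and with it
`r(C)`, from being small. -/

namespace CoxeterLog

section LinearAlgebra

open Matrix

/-! ### D-optimal designs: maximizing the determinant over a hull of rank one matrices -/

section OptimalDesign

variable {W : Type*}

/-- The closed convex hull of the rank one matrices `v vᵀ` with `v ∈ S`. -/
def outerHull (S : Set (W → ℝ)) : Set (Matrix W W ℝ) :=
  closedConvexHull ℝ ((fun v => vecMulVec v v) '' S)

theorem vecMulVec_mem_outerHull {S : Set (W → ℝ)} {v : W → ℝ} (hv : v ∈ S) :
    vecMulVec v v ∈ outerHull S :=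
  subset_closedConvexHull (Set.mem_image_of_mem _ hv)

/-- Induction principle for designs: a closed condition that is affine in the matrix need only be
checked on rank one matrices. -/
theorem outerHull_subset {S : Set (W → ℝ)} {T : Set (Matrix W W ℝ)} (hconv : Convex ℝ T)
    (hclosed : IsClosed T) (h : ∀ v ∈ S, vecMulVec v v ∈ T) : outerHull S ⊆ T :=
  closedConvexHull_min (by rintro _ ⟨v, hv, rfl⟩; exact h v hv) hconv hclosed

theorem convex_outerHull {S : Set (W → ℝ)} : Convex ℝ (outerHull S) :=
  convex_closedConvexHull

theorem isClosed_outerHull {S : Set (W → ℝ)} : IsClosed (outerHull S) :=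
  isClosed_closedConvexHull

variable [Fintype W]

theorem isCompact_outerHull {S : Set (W → ℝ)} (hS : IsCompact S) : IsCompact (outerHull S) := by
  obtain ⟨c, hc⟩ := hS.isBounded.exists_norm_le
  refine (isCompact_Icc (a := -(c * c)) (b := c * c)).matrix.of_isClosed_subset
    isClosed_outerHull (outerHull_subset ?_ ?_ ?_)
  · intro A hA B hB s t hs ht hst i j
    exact convex_Icc (-(c * c)) (c * c) (hA i j) (hB i j) hs ht hst
  · exact (isCompact_Icc (a := -(c * c)) (b := c * c)).matrix.isClosed
  · intro v hv i j
    have h1 : |v i| ≤ c := (norm_le_pi_norm v i).trans (hc v hv)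
    have h2 : |v j| ≤ c := (norm_le_pi_norm v j).trans (hc v hv)
    rw [vecMulVec_apply]
    refine abs_le.1 ?_
    rw [abs_mul]
    exact mul_le_mul h1 h2 (abs_nonneg _) ((abs_nonneg _).trans h1)

theorem posSemidef_of_mem_outerHull {S : Set (W → ℝ)} {A : Matrix W W ℝ} (hA : A ∈ outerHull S) :
    A.PosSemidef := by
  have h1 : outerHull S ⊆ {N | Nᵀ = N} := by
    refine outerHull_subset ?_ ?_ ?_
    · intro A hA B hB s t _ _ _
      simp only [Set.mem_ofPred_eq] at hA hB ⊢
      rw [transpose_add, transpose_smul, transpose_smul, hA, hB]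
    · exact isClosed_eq (by fun_prop) (by fun_prop)
    · intro v _
      simp [transpose_vecMulVec]
  have h2 : ∀ x : W → ℝ, outerHull S ⊆ {N | 0 ≤ x ⬝ᵥ N *ᵥ x} := by
    intro x
    refine outerHull_subset ?_ ?_ ?_
    · intro A hA B hB s t hs ht _
      simp only [Set.mem_ofPred_eq] at hA hB ⊢
      rw [add_mulVec, smul_mulVec, smul_mulVec, dotProduct_add, dotProduct_smul, dotProduct_smul]
      exact add_nonneg (mul_nonneg hs hA) (mul_nonneg ht hB)
    · exact isClosed_le (by fun_prop) (by fun_prop)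
    · intro v _
      simp only [Set.mem_ofPred_eq, vecMulVec_mulVec]
      rw [op_smul_eq_smul, dotProduct_smul, smul_eq_mul, dotProduct_comm x v]
      exact mul_self_nonneg _
  refine .of_dotProduct_mulVec_nonneg ?_ fun x => by simpa using h2 x hA
  simpa [IsHermitian, conjTranspose_eq_transpose_of_trivial] using h1 hA

variable [DecidableEq W]

theorem exists_det_maximizer {S : Set (W → ℝ)} (hS : IsCompact S)
    (hpd : ∃ N ∈ outerHull S, N.PosDef) :
    ∃ A ∈ outerHull S, A.PosDef ∧ ∀ N ∈ outerHull S, N.det ≤ A.det := by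
  obtain ⟨N, hN, hNpd⟩ := hpd
  obtain ⟨A, hA, hmax⟩ := (isCompact_outerHull hS).exists_isMaxOn ⟨N, hN⟩
    (f := Matrix.det) (by fun_prop)
  refine ⟨A, hA, ?_, fun N hN => hmax hN⟩
  exact (posSemidef_of_mem_outerHull hA).posDef_iff_det_ne_zero.2
    (hNpd.det_pos.trans_le (hmax hN)).ne'

/-- First order optimality condition for a maximizer of the determinant. -/
theorem trace_inv_mul_le {T : Set (Matrix W W ℝ)} (hT : Convex ℝ T) {A N : Matrix W W ℝ}
    (hA : A ∈ T) (hApd : A.PosDef) (hmax : ∀ N ∈ T, N.det ≤ A.det) (hN : N ∈ T) :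
    (A⁻¹ * N).trace ≤ Fintype.card W := by
  have hu : IsUnit A.det := hApd.det_pos.ne'.isUnit
  set M := A⁻¹ * N - 1 with hM
  -- Along the segment from `A` to `N` the determinant is `det A * (1 + t * tr M + t² * p(t))`.
  -- Maximality at `t = 0` bounds the slope `tr M` by `0`, after division by `t` and `t → 0`.
  set p := (det (1 + (Polynomial.X : Polynomial ℝ) • M.map Polynomial.C)).divX.divX with hp
  have key : ∀ t ∈ Set.Ioc (0 : ℝ) 1, M.trace + p.eval t * t ≤ 0 := by
    intro t ht
    have hmem : A + t • (N - A) ∈ T := hT.add_smul_sub_mem hA hN ⟨ht.1.le, ht.2⟩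
    have heq : A + t • (N - A) = A * (1 + t • M) := by
      rw [hM, mul_add, mul_one, mul_smul_comm, mul_sub, ← mul_assoc, mul_nonsing_inv _ hu, one_mul,
        mul_one]
    have h1 := hmax _ hmem
    rw [heq, det_mul, det_one_add_smul, ← hp] at h1
    have h2 : 1 + M.trace * t + p.eval t * t ^ 2 ≤ 1 := by
      have := hApd.det_pos
      by_contra! h
      nlinarith
    by_contra! h
    nlinarith [mul_pos h ht.1]
  have hlim : Filter.Tendsto (fun t : ℝ => M.trace + p.eval t * t) (nhdsWithin 0 (Set.Ioi 0))
      (nhds (M.trace + p.eval 0 * 0)) := by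
    refine Filter.Tendsto.mono_left (Continuous.tendsto ?_ 0) nhdsWithin_le_nhds
    fun_prop
  have h0 : M.trace + p.eval 0 * 0 ≤ 0 := by
    refine le_of_tendsto hlim ?_
    filter_upwards [Ioc_mem_nhdsGT one_pos] with t ht using key t ht
  rw [hM, trace_sub, trace_one] at h0
  linarith

/-- Writing `P = Rᴴ R` and `Q = Uᴴ U`, the trace is the squared Frobenius norm of `U D Rᴴ`, with `R`
and `U` invertible. -/
theorem eq_zero_of_trace_mul_mul_mul_nonpos {P Q D : Matrix W W ℝ} (hP : P.PosDef) (hQ : Q.PosDef)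
    (hD : Dᵀ = D) (h : (P * D * Q * D).trace ≤ 0) : D = 0 := by
  open scoped MatrixOrder in
  obtain ⟨R, hRu, hR⟩ := CStarAlgebra.isStrictlyPositive_iff_eq_star_mul_self.mp
    hP.isStrictlyPositive
  open scoped MatrixOrder in
  obtain ⟨U, hUu, hU⟩ := CStarAlgebra.isStrictlyPositive_iff_eq_star_mul_self.mp
    hQ.isStrictlyPositive
  rw [star_eq_conjTranspose] at hR hU
  have htr : (P * D * Q * D).trace = ((U * D * Rᴴ)ᴴ * (U * D * Rᴴ)).trace := by
    rw [hR, hU, conjTranspose_mul, conjTranspose_mul, conjTranspose_conjTranspose,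
      conjTranspose_eq_transpose_of_trivial D, hD]
    simp only [Matrix.mul_assoc]
    rw [trace_mul_comm]
    simp only [Matrix.mul_assoc]
  have h0 : ((U * D * Rᴴ)ᴴ * (U * D * Rᴴ)).trace = 0 :=
    le_antisymm (htr ▸ h) (posSemidef_conjTranspose_mul_self _).trace_nonneg
  rw [trace_conjTranspose_mul_self_eq_zero_iff] at h0
  have hRu' : IsUnit Rᴴ := hRu.star
  have := hRu'.mul_left_eq_zero.1 h0
  exact hUu.mul_right_eq_zero.1 this

/-- Adding the first order conditions at the two maximizers gives `tr (A⁻¹ (B - A) B⁻¹ (B - A)) ≤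
0`; this takes the place of strict concavity of `log det`. -/
theorem det_maximizer_unique {T : Set (Matrix W W ℝ)} (hT : Convex ℝ T) {A B : Matrix W W ℝ}
    (hA : A ∈ T) (hApd : A.PosDef) (hmax : ∀ N ∈ T, N.det ≤ A.det)
    (hB : B ∈ T) (hBpd : B.PosDef) (hAB : B.det = A.det) : B = A := by
  have h1 := trace_inv_mul_le hT hA hApd hmax hB
  have h2 := trace_inv_mul_le hT hB hBpd (fun N hN => hAB ▸ hmax N hN) hA
  have hua : IsUnit A.det := hApd.det_pos.ne'.isUnit
  have hub : IsUnit B.det := hBpd.det_pos.ne'.isUnit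
  have hsymm : (B - A)ᵀ = B - A := by
    have ha := hApd.isHermitian
    have hb := hBpd.isHermitian
    rw [IsHermitian, conjTranspose_eq_transpose_of_trivial] at ha hb
    rw [transpose_sub, ha, hb]
  refine sub_eq_zero.1 (eq_zero_of_trace_mul_mul_mul_nonpos hApd.inv hBpd.inv hsymm ?_)
  have : A⁻¹ * (B - A) * B⁻¹ * (B - A) = A⁻¹ * B + B⁻¹ * A - 1 - 1 := by
    rw [mul_sub A⁻¹, nonsing_inv_mul _ hua, sub_mul, one_mul, mul_assoc A⁻¹ B,
      mul_nonsing_inv _ hub, mul_one, sub_mul, mul_sub, mul_sub, nonsing_inv_mul _ hua,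
      nonsing_inv_mul _ hub]
    abel
  rw [this, trace_sub, trace_sub, trace_add, trace_one]
  linarith

theorem mul_mul_transpose_mem_outerHull {S : Set (W → ℝ)} {P : Matrix W W ℝ}
    (hP : ∀ v ∈ S, P *ᵥ v ∈ S) {A : Matrix W W ℝ} (hA : A ∈ outerHull S) :
    P * A * Pᵀ ∈ outerHull S := by
  have : outerHull S ⊆ {N | P * N * Pᵀ ∈ outerHull S} := by
    refine outerHull_subset ?_ ?_ ?_
    · intro A hA B hB s t hs ht hst
      have := convex_outerHull hA hB hs ht hst
      simpa [mul_add, add_mul] using this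
    · exact isClosed_outerHull.preimage (by fun_prop)
    · intro v hv
      simp only [Set.mem_ofPred_eq, mul_vecMulVec, vecMulVec_mul, vecMul_transpose]
      exact vecMulVec_mem_outerHull (hP v hv)
  exact this hA

/-- Cauchy–Schwarz for the inner product defined by `A`, applied to `A⁻¹ v` and `w`. -/
theorem sq_dotProduct_le_inv {A : Matrix W W ℝ} (hA : A.PosDef) (v w : W → ℝ) :
    (v ⬝ᵥ w) ^ 2 ≤ (v ⬝ᵥ A⁻¹ *ᵥ v) * (w ⬝ᵥ A *ᵥ w) := by
  have hu : IsUnit A.det := hA.det_pos.ne'.isUnit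
  set z := A⁻¹ *ᵥ v with hz
  have hAz : A *ᵥ z = v := by rw [hz, mulVec_mulVec, mul_nonsing_inv _ hu, one_mulVec]
  have hAt : Aᵀ = A := by
    have := hA.isHermitian
    rwa [IsHermitian, conjTranspose_eq_transpose_of_trivial] at this
  have hzw : z ⬝ᵥ A *ᵥ w = v ⬝ᵥ w := by
    rw [dotProduct_mulVec, ← mulVec_transpose, hAt, hAz]
  rcases eq_or_ne w 0 with rfl | hw
  · simp
  have hα : 0 < w ⬝ᵥ A *ᵥ w := by simpa using hA.dotProduct_mulVec_pos hw
  set α := w ⬝ᵥ A *ᵥ w with hαd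
  have h0 : 0 ≤ (α • z - (v ⬝ᵥ w) • w) ⬝ᵥ A *ᵥ (α • z - (v ⬝ᵥ w) • w) := by
    simpa using hA.posSemidef.dotProduct_mulVec_nonneg (α • z - (v ⬝ᵥ w) • w)
  rw [mulVec_sub, mulVec_smul, mulVec_smul, hAz, dotProduct_sub, sub_dotProduct, sub_dotProduct,
    dotProduct_smul, dotProduct_smul, dotProduct_smul, dotProduct_smul, smul_dotProduct,
    smul_dotProduct, smul_dotProduct, smul_dotProduct, hzw, ← hαd, dotProduct_comm z v,
    dotProduct_comm w v] at h0
  simp only [smul_eq_mul] at h0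
  have : 0 ≤ α * ((v ⬝ᵥ z) * α - (v ⬝ᵥ w) ^ 2) := by linarith
  linarith [nonneg_of_mul_nonneg_right this hα]

/-- Existence of a `D`-optimal design, invariant under the orthogonal symmetries of `S`. -/
theorem exists_optimal_design {S : Set (W → ℝ)} (hS : IsCompact S)
    (hpd : ∃ N ∈ outerHull S, N.PosDef) :
    ∃ A ∈ outerHull S, A.PosDef ∧
      (∀ v ∈ S, ∀ w, (v ⬝ᵥ w) ^ 2 ≤ Fintype.card W * (w ⬝ᵥ A *ᵥ w)) ∧
      ∀ P : Matrix W W ℝ, P * Pᵀ = 1 → (∀ v ∈ S, P *ᵥ v ∈ S) → P * A * Pᵀ = A := by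
  obtain ⟨A, hA, hApd, hmax⟩ := exists_det_maximizer hS hpd
  refine ⟨A, hA, hApd, fun v hv w => ?_, fun P hP hPS => ?_⟩
  · refine (sq_dotProduct_le_inv hApd v w).trans (mul_le_mul_of_nonneg_right ?_ ?_)
    · have := trace_inv_mul_le convex_outerHull hA hApd hmax (vecMulVec_mem_outerHull hv)
      rwa [mul_vecMulVec, trace_vecMulVec, dotProduct_comm] at this
    · simpa using hApd.posSemidef.dotProduct_mulVec_nonneg w
  · have hB := mul_mul_transpose_mem_outerHull hPS hA
    have hdet : (P * A * Pᵀ).det = A.det := by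
      have h1 : P.det * Pᵀ.det = 1 := by rw [← det_mul, hP, det_one]
      rw [det_mul, det_mul, mul_right_comm, h1, one_mul]
    refine det_maximizer_unique convex_outerHull hA hApd hmax hB ?_ hdet
    exact (posSemidef_of_mem_outerHull hB).posDef_iff_det_ne_zero.2 (hdet ▸ hApd.det_pos.ne')

end OptimalDesign

/-! ### The invariant ellipsoid of an invariant convex body -/

theorem exists_posDef_mem_outerHull {W ι : Type*} [Fintype W] [Fintype ι] [Nonempty ι]
    {S : Set (W → ℝ)} (v : ι → W → ℝ) (hv : ∀ p, v p ∈ S)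
    (hspan : ∀ w, (∀ p, v p ⬝ᵥ w = 0) → w = 0) : ∃ N ∈ outerHull S, N.PosDef := by
  have hc : (0 : ℝ) < (Fintype.card ι : ℝ)⁻¹ := by
    have : 0 < Fintype.card ι := Fintype.card_pos
    positivity
  have hmem : ∑ p, (Fintype.card ι : ℝ)⁻¹ • vecMulVec (v p) (v p) ∈ outerHull S := by
    refine convex_outerHull.sum_mem (fun _ _ => hc.le) ?_
      fun p _ => vecMulVec_mem_outerHull (hv p)
    simp
  refine ⟨_, hmem, .of_dotProduct_mulVec_pos (posSemidef_of_mem_outerHull hmem).isHermitian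
    fun {w} hw => ?_⟩
  have h1 : star w ⬝ᵥ (∑ p, (Fintype.card ι : ℝ)⁻¹ • vecMulVec (v p) (v p)) *ᵥ w
      = ∑ p, (Fintype.card ι : ℝ)⁻¹ * (v p ⬝ᵥ w) ^ 2 := by
    rw [sum_mulVec, dotProduct_sum]
    refine Finset.sum_congr rfl fun p _ => ?_
    rw [smul_mulVec, vecMulVec_mulVec, op_smul_eq_smul, dotProduct_smul, dotProduct_smul,
      star_trivial, dotProduct_comm w]
    simp [sq]
  rw [h1]
  obtain ⟨p, hp⟩ : ∃ p, v p ⬝ᵥ w ≠ 0 := by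
    by_contra! h
    exact hw (hspan w h)
  exact Finset.sum_pos' (fun _ _ => by positivity) ⟨p, Finset.mem_univ _, by positivity⟩

/-- The matrix of an orthogonal transformation in the standard basis. -/
noncomputable def orthMatrix {n : ℕ} (g : O n) : Matrix (Fin n) (Fin n) ℝ :=
  Matrix.toEuclideanLin.symm (g.toLinearEquiv : E n →ₗ[ℝ] E n)

theorem orthMatrix_mulVec {n : ℕ} (g : O n) (x : E n) :
    orthMatrix g *ᵥ x.ofLp = (g x).ofLp := by
  have h : Matrix.toEuclideanLin (orthMatrix g) = (g.toLinearEquiv : E n →ₗ[ℝ] E n) := by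
    simp [orthMatrix]
  have := congrArg (fun f => (f x).ofLp) h
  simpa [Matrix.toLpLin_apply] using this

theorem transpose_mul_orthMatrix {n : ℕ} (g : O n) : (orthMatrix g)ᵀ * orthMatrix g = 1 := by
  refine Matrix.ext_of_mulVec_single fun i => dotProduct_eq _ _ fun u => ?_
  have h := g.inner_map_map (WithLp.toLp 2 u) (WithLp.toLp 2 (Pi.single i 1))
  rw [EuclideanSpace.inner_eq_star_dotProduct, EuclideanSpace.inner_eq_star_dotProduct,
    ← orthMatrix_mulVec, ← orthMatrix_mulVec] at h
  simp only [star_trivial] at h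
  rw [← mulVec_mulVec, dotProduct_comm, mulVec_transpose, dotProduct_comm, ← dotProduct_mulVec, h,
    one_mulVec]

/-- The point `(x, 1)` of `ℝⁿ⁺¹`. -/
def affineLift {n : ℕ} (x : E n) : Fin n ⊕ Unit → ℝ :=
  Sum.elim x.ofLp fun _ => 1

theorem affineLift_dotProduct {n : ℕ} (x : E n) (u : E n) (t : ℝ) :
    affineLift x ⬝ᵥ Sum.elim u.ofLp (fun _ => t) = inner ℝ u x + t := by
  simp [affineLift, dotProduct, PiLp.inner_apply]

theorem continuous_affineLift {n : ℕ} : Continuous (affineLift (n := n)) := by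
  refine continuous_pi fun i => ?_
  rcases i with i | i
  · simp only [affineLift, Sum.elim_inl]; fun_prop
  · simp only [affineLift, Sum.elim_inr]; fun_prop

theorem exists_posDef_mem_outerHull_affineLift {n : ℕ} {C : Set (E n)}
    (hC : (interior C).Nonempty) : ∃ N ∈ outerHull (affineLift '' C), N.PosDef := by
  obtain ⟨y, hy⟩ := hC
  obtain ⟨ε, hε, hball⟩ := Metric.isOpen_iff.1 isOpen_interior y hy
  -- The vertices of a small simplex in `C`: affinely independent points, so their lifts span
  -- `ℝⁿ⁺¹`.
  let p : Option (Fin n) → E n := fun o => o.elim y fun i => y + EuclideanSpace.single i (ε / 2)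
  have hp : ∀ o, p o ∈ C := by
    intro o
    refine interior_subset (hball ?_)
    rcases o with _ | i
    · simpa [p] using hε
    · simp only [p, Option.elim, Metric.mem_ball, dist_self_add_left, PiLp.norm_single,
        Real.norm_eq_abs, abs_of_pos (half_pos hε)]
      linarith
  refine exists_posDef_mem_outerHull (fun o => affineLift (p o))
    (fun o => Set.mem_image_of_mem _ (hp o)) fun w hw => ?_
  obtain ⟨z, t, rfl⟩ : ∃ (z : E n) (t : ℝ), w = Sum.elim z.ofLp fun _ => t :=
    ⟨WithLp.toLp 2 (w ∘ Sum.inl), w (Sum.inr ()), by funext i; rcases i with i | i <;> rfl⟩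
  simp only [affineLift_dotProduct] at hw
  have h0 := hw none
  have hz : z = 0 := by
    ext i
    have h1 := hw (some i)
    simp only [p, Option.elim, inner_add_right, EuclideanSpace.inner_single_right] at h0 h1
    have h2 : ε / 2 * z i = 0 := by
      simp at h1
      linarith
    exact (mul_eq_zero.1 h2).resolve_left (half_pos hε).ne'
  rw [hz, inner_zero_left, zero_add] at h0
  funext i
  rcases i with i | i
  · simp [hz]
  · exact h0

theorem inner_le_supportFunction {n : ℕ} {C : Set (E n)} (hC : IsCompact C) (u : E n) {x : E n}
    (hx : x ∈ C) : inner ℝ u x ≤ supportFunction C u := by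
  refine le_csSup ?_ (Set.mem_image_of_mem _ hx)
  exact (hC.image (by fun_prop)).bddAbove

/-- An invariant convex body in `ℝⁿ` is sandwiched between homothetic copies, of ratio `n`, of an
invariant centred ellipsoid. The squared support function of the ellipsoid is the quadratic form of
the matrix `M`. -/
theorem exists_john_matrix {n : ℕ} (hn : 0 < n) {G : Subgroup (O n)} (hfix : NoNonzeroFixedPoint G)
    {C : Set (E n)} (hcomp : IsCompact C) (hint : (interior C).Nonempty) (hC : InvariantSet G C) :
    ∃ M : Matrix (Fin n) (Fin n) ℝ, M.PosDef ∧
      (∀ g ∈ G, orthMatrix g * M = M * orthMatrix g) ∧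
      (∀ x ∈ C, ∀ u : E n, inner ℝ u x ^ 2 ≤ n * (u.ofLp ⬝ᵥ M *ᵥ u.ofLp)) ∧
      ∀ u : E n, √(u.ofLp ⬝ᵥ M *ᵥ u.ofLp) ≤ √n * supportFunction C u := by
  obtain ⟨A, hA, hApd, hAC, hAinv⟩ := exists_optimal_design
    (hcomp.image continuous_affineLift) (exists_posDef_mem_outerHull_affineLift hint)
  have hPG : ∀ g ∈ G, fromBlocks (orthMatrix g) 0 0 1 * A * (fromBlocks (orthMatrix g) 0 0 1)ᵀ
      = A := by
    intro g hg
    refine hAinv _ ?_ ?_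
    · have := mul_eq_one_comm.1 (transpose_mul_orthMatrix g)
      simp [fromBlocks_transpose, fromBlocks_multiply, this]
    · rintro _ ⟨x, hx, rfl⟩
      refine ⟨g x, ?_, ?_⟩
      · rw [← hC g hg]; exact Set.mem_image_of_mem _ hx
      · rw [affineLift, affineLift, fromBlocks_mulVec]
        ext i
        rcases i with i | i <;> simp [orthMatrix_mulVec]
  have hA22 : A.toBlocks₂₂ = 1 := by
    have : outerHull (affineLift '' C) ⊆ {N | N (Sum.inr ()) (Sum.inr ()) = 1} := by
      refine outerHull_subset ?_ ?_ ?_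
      · intro A hA B hB s t _ _ hst
        simp only [Set.mem_ofPred_eq] at hA hB ⊢
        simp [hA, hB, hst]
      · exact isClosed_eq (by fun_prop) (by fun_prop)
      · rintro _ ⟨x, _, rfl⟩
        simp [affineLift, vecMulVec_apply]
    ext i j
    simpa [toBlocks₂₂] using this hA
  set M := A.toBlocks₁₁ with hM
  have hblocks : A = fromBlocks M A.toBlocks₁₂ A.toBlocks₂₁ 1 := by
    rw [hM, ← hA22, fromBlocks_toBlocks]
  have hsym : Aᵀ = A := by
    have := hApd.isHermitian
    rwa [IsHermitian, conjTranspose_eq_transpose_of_trivial] at this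
  have hPG' : ∀ g ∈ G, orthMatrix g * M * (orthMatrix g)ᵀ = M ∧
      orthMatrix g * A.toBlocks₁₂ = A.toBlocks₁₂ := by
    intro g hg
    have h := hPG g hg
    rw [hblocks, fromBlocks_transpose, fromBlocks_multiply, fromBlocks_multiply, fromBlocks_inj] at h
    simp at h
    exact ⟨h.1, h.2.1⟩
  -- The off-diagonal block is the barycentre of the design, a point fixed by `G`.
  have h12 : A.toBlocks₁₂ = 0 := by
    have hm : (WithLp.toLp 2 fun i => A.toBlocks₁₂ i () : E n) = 0 := by
      refine hfix _ fun g hg => ?_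
      ext i
      rw [← orthMatrix_mulVec]
      exact congrFun (congrFun (hPG' g hg).2 i) ()
    ext i j
    simpa using congrArg (fun x : E n => x i) hm
  have h21 : A.toBlocks₂₁ = 0 := by
    have : A.toBlocks₂₁ = A.toBlocks₁₂ᵀ := by
      ext i j
      exact congrFun (congrFun hsym (Sum.inl j)) (Sum.inr i)
    rw [this, h12, transpose_zero]
  rw [h12, h21] at hblocks
  have hform : ∀ (u : E n) (t : ℝ), Sum.elim u.ofLp (fun _ => t) ⬝ᵥ A *ᵥ Sum.elim u.ofLp (fun _ => t)
      = u.ofLp ⬝ᵥ M *ᵥ u.ofLp + t ^ 2 := by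
    intro u t
    rw [hblocks, fromBlocks_mulVec]
    simp [dotProduct, sq]
  have hMpd : M.PosDef := hApd.submatrix Sum.inl_injective
  have hnn : ∀ u : E n, 0 ≤ u.ofLp ⬝ᵥ M *ᵥ u.ofLp := fun u => by
    simpa using hMpd.posSemidef.dotProduct_mulVec_nonneg u.ofLp
  have hn' : (0 : ℝ) < n := by exact_mod_cast hn
  have hupper : ∀ x ∈ C, ∀ u : E n, inner ℝ u x ^ 2 ≤ n * (u.ofLp ⬝ᵥ M *ᵥ u.ofLp) := by
    intro x hx u
    -- This choice of the last coordinate improves the factor `n + 1` of the design in dimension `n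
    -- + 1` to `n`.
    have h := hAC _ (Set.mem_image_of_mem _ hx) (Sum.elim u.ofLp fun _ => inner ℝ u x / n)
    rw [affineLift_dotProduct, hform, Fintype.card_sum, Fintype.card_fin, Fintype.card_unit] at h
    push_cast at h
    have h1 : inner ℝ u x + inner ℝ u x / n = (n + 1) * (inner ℝ u x / n) := by
      field_simp
    have h2 : inner ℝ u x = n * (inner ℝ u x / n) := by field_simp
    rw [h1] at h
    set s : ℝ := inner ℝ u x / n
    rw [h2]
    have h3 : (n + 1) * s ^ 2 ≤ u.ofLp ⬝ᵥ M *ᵥ u.ofLp + s ^ 2 := by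
      refine le_of_mul_le_mul_left ?_ (show (0 : ℝ) < n + 1 by positivity)
      linarith
    nlinarith
  refine ⟨M, hMpd, fun g hg => ?_, hupper, fun u => ?_⟩
  · conv_rhs => rw [← (hPG' g hg).1]
    rw [mul_assoc _ (orthMatrix g)ᵀ, transpose_mul_orthMatrix, mul_one]
  · set H := supportFunction C u
    set σ := √(u.ofLp ⬝ᵥ M *ᵥ u.ofLp) with hσ
    have hσ2 : σ ^ 2 = u.ofLp ⬝ᵥ M *ᵥ u.ofLp := Real.sq_sqrt (hnn u)
    -- For `x ∈ C` the number `t = ⟨u, x⟩` lies in `[-√n σ, H]`, so `(H - t)(t + √n σ) ≥ 0`.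
    -- Averaged over the design, which has mean `0` and second moment `σ²`, this reads `σ² ≤ H √n
    -- σ`.
    have hsub : outerHull (affineLift '' C) ⊆ {N |
        Sum.elim u.ofLp (fun _ => 0) ⬝ᵥ N *ᵥ Sum.elim u.ofLp (fun _ => 0)
          ≤ H * (√n * σ) * N (Sum.inr ()) (Sum.inr ())
            + (H - √n * σ) * ∑ i, u i * N (Sum.inl i) (Sum.inr ())} := by
      refine outerHull_subset ?_ ?_ ?_
      · intro A hA B hB s t hs ht _
        simp only [Set.mem_ofPred_eq] at hA hB ⊢
        rw [add_mulVec, smul_mulVec, smul_mulVec, dotProduct_add, dotProduct_smul, dotProduct_smul]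
        simp only [Matrix.add_apply, Matrix.smul_apply, smul_eq_mul]
        have : ∑ i, u i * (s * A (Sum.inl i) (Sum.inr ()) + t * B (Sum.inl i) (Sum.inr ()))
            = s * (∑ i, u i * A (Sum.inl i) (Sum.inr ()))
              + t * ∑ i, u i * B (Sum.inl i) (Sum.inr ()) := by
          rw [Finset.mul_sum, Finset.mul_sum, ← Finset.sum_add_distrib]
          exact Finset.sum_congr rfl fun i _ => by ring
        rw [this]
        linarith [mul_le_mul_of_nonneg_left hA hs, mul_le_mul_of_nonneg_left hB ht]
      · exact isClosed_le (by fun_prop) (by fun_prop)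
      · rintro _ ⟨x, hx, rfl⟩
        have h1 : inner ℝ u x ≤ H := inner_le_supportFunction hcomp u hx
        have h2 : -(√n * σ) ≤ inner ℝ u x := by
          have := hupper x hx u
          rw [← hσ2, ← Real.sq_sqrt hn'.le, ← mul_pow] at this
          exact (abs_le_of_sq_le_sq' this (by positivity)).1
        have h3 : ∑ i, u i * vecMulVec (affineLift x) (affineLift x) (Sum.inl i) (Sum.inr ())
            = inner ℝ u x := by
          simp [affineLift, vecMulVec_apply, PiLp.inner_apply, mul_comm]
        simp only [Set.mem_ofPred_eq]
        rw [h3, vecMulVec_mulVec, op_smul_eq_smul, dotProduct_smul, affineLift_dotProduct,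
          dotProduct_comm, affineLift_dotProduct]
        simp only [vecMulVec_apply, affineLift, Sum.elim_inr, smul_eq_mul]
        nlinarith
    have := hsub hA
    simp only [Set.mem_ofPred_eq] at this
    rw [hform, ← hσ2, hblocks] at this
    simp at this
    rcases (Real.sqrt_nonneg (u.ofLp ⬝ᵥ M *ᵥ u.ofLp)).eq_or_lt' with h0 | h0
    · rw [← hσ] at h0
      rw [h0]
      have hH : 0 ≤ H := by
        obtain ⟨x, hx⟩ := hint.mono interior_subset
        have h4 := hupper x hx u
        rw [← hσ2, h0] at h4
        have h5 : inner ℝ u x = 0 := by nlinarith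
        exact h5 ▸ inner_le_supportFunction hcomp u hx
      positivity
    · rw [← hσ] at h0
      refine le_of_mul_le_mul_right ?_ h0
      linarith

/-- The diagonalized form of `exists_john_matrix`. -/
theorem exists_john_basis {n : ℕ} (hn : 0 < n) {G : Subgroup (O n)} (hfix : NoNonzeroFixedPoint G)
    {C : Set (E n)} (hcomp : IsCompact C) (hint : (interior C).Nonempty) (hC : InvariantSet G C) :
    ∃ (b : OrthonormalBasis (Fin n) ℝ (E n)) (r : Fin n → ℝ), Antitone r ∧ (∀ i, 0 < r i) ∧
      (∀ g ∈ G, ∀ i j, r i ≠ r j → inner ℝ (b i) (g (b j)) = 0) ∧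
      (∀ x ∈ C, ∀ u : E n, inner ℝ u x ^ 2 ≤ n * ∑ i, (r i * inner ℝ (b i) u) ^ 2) ∧
      ∀ u : E n, √(∑ i, (r i * inner ℝ (b i) u) ^ 2) ≤ √n * supportFunction C u := by
  obtain ⟨M, hM, hMG, hup, hlow⟩ := exists_john_matrix hn hfix hcomp hint hC
  set T := Matrix.toEuclideanLin M with hT
  have hTs : T.IsSymmetric := Matrix.isSymmetric_toEuclideanLin_iff.2 hM.isHermitian
  have hfin : Module.finrank ℝ (E n) = n := finrank_euclideanSpace_fin
  set b := hTs.eigenvectorBasis hfin with hb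
  set l := hTs.eigenvalues hfin with hl
  have hTb : ∀ i, T (b i) = l i • b i := fun i => hTs.apply_eigenvectorBasis hfin i
  have hTinner : ∀ u : E n, u.ofLp ⬝ᵥ M *ᵥ u.ofLp = inner ℝ (T u) u := by
    intro u
    rw [EuclideanSpace.inner_eq_star_dotProduct, hT, Matrix.toLpLin_apply]
    simp
  have hlpos : ∀ i, 0 < l i := by
    intro i
    have h0 : (b i).ofLp ≠ 0 := by
      intro h
      exact b.orthonormal.ne_zero i (WithLp.ofLp_injective 2 h)
    have := hM.dotProduct_mulVec_pos h0
    rw [star_trivial, hTinner, hTb, inner_smul_left, real_inner_self_eq_norm_sq,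
      b.orthonormal.1 i] at this
    simpa using this
  have hsum : ∀ u : E n, u.ofLp ⬝ᵥ M *ᵥ u.ofLp = ∑ i, (√(l i) * inner ℝ (b i) u) ^ 2 := by
    intro u
    rw [hTinner, ← b.sum_inner_mul_inner]
    refine Finset.sum_congr rfl fun i _ => ?_
    rw [hTs u (b i), hTb, inner_smul_right, mul_pow, Real.sq_sqrt (hlpos i).le,
      real_inner_comm u]
    ring
  refine ⟨b, fun i => √(l i), ?_, fun i => Real.sqrt_pos.2 (hlpos i), ?_, ?_, ?_⟩
  · exact fun i j hij => Real.sqrt_le_sqrt (hTs.eigenvalues_antitone hfin hij)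
  · intro g hg i j hij
    -- `T` commutes with `g`, so `g (b j)` stays in the eigenspace of `l j`, orthogonal to those of
    -- other eigenvalues.
    have hcomm : T (g (b j)) = l j • g (b j) := by
      rw [← map_smul, ← hTb, hT, Matrix.toLpLin_apply, Matrix.toLpLin_apply]
      refine WithLp.ofLp_injective 2 ?_
      rw [← orthMatrix_mulVec, ← orthMatrix_mulVec, mulVec_mulVec, mulVec_mulVec, hMG g hg]
    have h1 := hTs (b i) (g (b j))
    rw [hcomm, hTb, inner_smul_left, inner_smul_right] at h1
    by_contra h0
    have : l i = l j := by simpa using mul_right_cancel₀ h0 h1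
    exact hij (congrArg Real.sqrt this)
  · intro x hx u
    rw [← hsum]
    exact hup x hx u
  · intro u
    rw [← hsum]
    exact hlow u

end LinearAlgebra

/-! ### Volumes, support functions and radii -/

theorem volume_box {n : ℕ} (b : OrthonormalBasis (Fin n) ℝ (E n)) (a : Fin n → ℝ) :
    volume {x : E n | ∀ i, |inner ℝ (b i) x| ≤ a i} = ∏ i, ENNReal.ofReal (2 * a i) := by
  have hmp := (PiLp.volume_preserving_ofLp (Fin n)).comp b.measurePreserving_repr
  have hset : {x : E n | ∀ i, |inner ℝ (b i) x| ≤ a i}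
      = ((WithLp.ofLp : E n → Fin n → ℝ) ∘ b.repr) ⁻¹' Set.Icc (-a) a := by
    ext x
    simp only [Set.mem_ofPred_eq, Set.mem_preimage, Set.mem_Icc, Pi.le_def, ← forall_and, abs_le,
      Function.comp_apply, b.repr_apply_apply, Pi.neg_apply]
  rw [hset, hmp.measure_preimage measurableSet_Icc.nullMeasurableSet, Real.volume_Icc_pi]
  exact Finset.prod_congr rfl fun i _ => by rw [Pi.neg_apply]; ring_nf

/-- A ball of radius larger than `n ≥ √n` contains the cube `[-1, 1]ⁿ`, of volume `2ⁿ > 1`. -/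
theorem radius_unitVolumeBall_le {n : ℕ} (hn : 1 ≤ n) :
    (volume.real (Metric.ball (0 : E n) 1)) ^ (-(1 : ℝ) / n) ≤ n := by
  by_contra! h
  have hsub : {x : E n | ∀ i, |inner ℝ (EuclideanSpace.basisFun (Fin n) ℝ i) x| ≤ (1 : ℝ)}
      ⊆ unitVolumeBall n := by
    intro x hx
    rw [unitVolumeBall, mem_closedBall_zero_iff]
    refine le_trans ?_ h.le
    have h1 : ‖x‖ ^ 2 ≤ n := by
      rw [EuclideanSpace.real_norm_sq_eq]
      refine (Finset.sum_le_card_nsmul _ _ 1 fun i _ => ?_).trans (by simp)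
      have := hx i
      rw [EuclideanSpace.basisFun_inner] at this
      exact (sq_le_one_iff_abs_le_one _).2 this
    have h2 : (1 : ℝ) ≤ n := by exact_mod_cast hn
    nlinarith [norm_nonneg x]
  have := measure_mono (μ := volume) hsub
  rw [volume_box, volume_unitVolumeBall hn] at this
  simp only [mul_one, Finset.prod_const, Finset.card_univ, Fintype.card_fin,
    ENNReal.ofReal_ofNat] at this
  have h2 : (1 : ENNReal) < 2 ^ n := one_lt_pow₀ (by norm_num) (by omega)
  exact absurd this h2.not_ge

theorem supportFunction_closedBall {n : ℕ} {ρ : ℝ} (hρ : 0 ≤ ρ) {u : E n} (hu : ‖u‖ = 1) :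
    supportFunction (Metric.closedBall (0 : E n) ρ) u = ρ := by
  refine IsGreatest.csSup_eq ⟨⟨ρ • u, ?_, ?_⟩, ?_⟩
  · rw [mem_closedBall_zero_iff, norm_smul, hu, mul_one, Real.norm_of_nonneg hρ]
  · simp [inner_smul_right, hu]
  · rintro _ ⟨x, hx, rfl⟩
    refine (real_inner_le_norm u x).trans ?_
    rw [hu, one_mul]
    exact mem_closedBall_zero_iff.1 hx

theorem integral_log_supportFunction_unitVolumeBall {n : ℕ} (hn : 1 ≤ n) (μ : Measure (Sph n))
    [IsProbabilityMeasure μ] :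
    ∫ u : Sph n, Real.log (supportFunction (unitVolumeBall n) (u : E n)) ∂μ ≤ Real.log n := by
  have h0 : 0 < volume.real (Metric.ball (0 : E n) 1) :=
    ENNReal.toReal_pos (Metric.measure_ball_pos volume _ one_pos).ne' measure_ball_lt_top.ne
  have hpos : 0 < (volume.real (Metric.ball (0 : E n) 1)) ^ (-(1 : ℝ) / n) := by positivity
  have : ∀ u : Sph n, supportFunction (unitVolumeBall n) (u : E n)
      = (volume.real (Metric.ball (0 : E n) 1)) ^ (-(1 : ℝ) / n) := fun u =>
    supportFunction_closedBall hpos.le (norm_eq_of_mem_sphere u)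
  simp only [this, integral_const, probReal_univ, one_smul]
  exact Real.log_le_log hpos (radius_unitVolumeBall_le hn)

/-- A point of the ball outside `C` would be strictly separated from `C` by some `u`, forcing
`h_C(u) < ρ‖u‖`. -/
theorem closedBall_subset_of_le_supportFunction {n : ℕ} {C : Set (E n)} (hconv : Convex ℝ C)
    (hclosed : IsClosed C) (hne : C.Nonempty) {ρ : ℝ}
    (h : ∀ u, ρ * ‖u‖ ≤ supportFunction C u) : Metric.closedBall (0 : E n) ρ ⊆ C := by
  intro x hx
  by_contra hxC
  obtain ⟨f, s, hfs, hsx⟩ := geometric_hahn_banach_closed_point hconv hclosed hxC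
  set u := (InnerProductSpace.toDual ℝ (E n)).symm f with hu
  have hf : ∀ y, f y = inner ℝ u y := fun y => by
    rw [hu, InnerProductSpace.toDual_symm_apply]
  have h1 : supportFunction C u ≤ s := by
    refine csSup_le (hne.image _) ?_
    rintro _ ⟨y, hy, rfl⟩
    exact (hf y).symm.le.trans (hfs y hy).le
  have h2 : inner ℝ u x ≤ ρ * ‖u‖ := by
    refine (real_inner_le_norm u x).trans ?_
    rw [mul_comm]
    exact mul_le_mul_of_nonneg_right (mem_closedBall_zero_iff.1 hx) (norm_nonneg _)
  have := h u
  rw [hf] at hsx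
  linarith

theorem continuous_supportFunction {n : ℕ} {C : Set (E n)} (hC : IsCompact C) :
    Continuous (supportFunction C) :=
  hC.continuous_sSup (f := fun u x : E n => inner ℝ u x) (by fun_prop)

theorem integrable_log_supportFunction {n : ℕ} {C : Set (E n)} (hC : IsCompact C)
    (hpos : ∀ u : Sph n, 0 < supportFunction C (u : E n)) (μ : Measure (Sph n))
    [IsProbabilityMeasure μ] :
    Integrable (fun u : Sph n => Real.log (supportFunction C (u : E n))) μ := by
  have : Continuous fun u : Sph n => Real.log (supportFunction C (u : E n)) :=
    ((continuous_supportFunction hC).comp continuous_subtype_val).log fun u => (hpos u).ne'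
  have hint := this.continuousOn.integrableOn_compact (μ := μ) isCompact_univ
  rwa [integrableOn_univ] at hint

theorem circumradius_le {n : ℕ} {C : Set (E n)} {ρ : ℝ} (hρ : 0 ≤ ρ) {x : E n}
    (h : C ⊆ Metric.closedBall x ρ) : circumradius C ≤ ρ :=
  csInf_le ⟨0, fun _ h => h.1⟩ ⟨hρ, x, h⟩

theorem le_of_closedBall_subset_closedBall {n : ℕ} {x y u : E n} (hu : ‖u‖ = 1) {r R : ℝ}
    (hr : 0 ≤ r) (h : Metric.closedBall x r ⊆ Metric.closedBall y R) : r ≤ R := by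
  have hru : ‖r • u‖ = r := by rw [norm_smul, hu, mul_one, Real.norm_of_nonneg hr]
  have h1 : x + r • u ∈ Metric.closedBall y R := h (by simp [hru])
  have h2 : x - r • u ∈ Metric.closedBall y R := h (by simp [hru])
  have h3 := dist_triangle_right (x + r • u) (x - r • u) y
  have h4 : dist (x + r • u) (x - r • u) = 2 * r := by
    rw [dist_eq_norm, add_sub_sub_cancel, ← two_smul ℝ, norm_smul, hru, Real.norm_ofNat]
  rw [Metric.mem_closedBall] at h1 h2
  linarith

/-- Boundedness and the unit vector `u` make the set of radii bounded above, so that `sSup` is not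
its default value `0`. -/
theorem le_inradius {n : ℕ} {C : Set (E n)} (hC : Bornology.IsBounded C) {r : ℝ} (hr : 0 ≤ r)
    {x u : E n} (hu : ‖u‖ = 1) (h : Metric.closedBall x r ⊆ C) : r ≤ inradius C := by
  obtain ⟨R, hR⟩ := hC.subset_closedBall 0
  refine le_csSup ⟨R, ?_⟩ ⟨hr, x, h⟩
  rintro r' ⟨hr', y, hy⟩
  exact le_of_closedBall_subset_closedBall hu hr' (hy.trans hR)

/-! ### Summation by parts, tubes around spans of short axes, and the logarithmic integral -/

theorem sum_mul_sub_succ {m : ℕ} (a : Fin (m + 1) → ℝ) :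
    ∑ j : Fin m, ((m : ℝ) - j) * (a j.castSucc - a j.succ) = (m + 1) * a 0 - ∑ i, a i := by
  induction m with
  | zero => simp
  | succ m ih =>
    have h := ih fun i => a i.succ
    rw [Fin.sum_univ_succ, Fin.sum_univ_succ (f := a)]
    have h2 : ∑ j : Fin m, (((m + 1 : ℕ) : ℝ) - (j.succ : ℕ)) *
        (a j.succ.castSucc - a j.succ.succ)
        = ∑ j : Fin m, ((m : ℝ) - j) * (a j.castSucc.succ - a j.succ.succ) := by
      refine Finset.sum_congr rfl fun j _ => ?_
      rw [Fin.succ_castSucc, Fin.val_succ]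
      push_cast
      ring
    rw [h2, h]
    simp only [Fin.val_zero, Fin.castSucc_zero, Fin.succ_zero_eq_one]
    push_cast
    ring

open Classical in
-- Take `k` to be the first index where `p` fails, or the last index if there is none. The terms
-- before `k` telescope to `a 0 - a k` and the later ones are nonnegative.
theorem exists_le_of_antitone {m : ℕ} (a : Fin (m + 1) → ℝ) (ha : Antitone a) (p : Fin m → Prop) :
    ∃ k : Fin (m + 1), (∀ j : Fin m, j.castSucc = k → ¬ p j) ∧
      a 0 - ∑ j : Fin m, (if p j then a j.castSucc - a j.succ else 0) ≤ a k := by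
  induction m with
  | zero => exact ⟨0, fun j => j.elim0, by simp⟩
  | succ m ih =>
    by_cases hp : p 0
    · obtain ⟨k, hk, hle⟩ := ih (fun i => a i.succ) (fun i j h => ha (Fin.succ_le_succ_iff.2 h))
        (fun j => p j.succ)
      refine ⟨k.succ, fun j hj => ?_, ?_⟩
      · rcases Fin.eq_zero_or_eq_succ j with rfl | ⟨j, rfl⟩
        · exact absurd hj.symm (Fin.succ_ne_zero k)
        · exact hk j (Fin.succ_injective _ hj)
      · rw [Fin.sum_univ_succ, if_pos hp]
        simp only [Fin.succ_castSucc] at hle ⊢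
        simp only [Fin.castSucc_zero] at hle ⊢
        linarith
    · refine ⟨0, fun j hj => ?_, ?_⟩
      · have : j = 0 := Fin.castSucc_injective _ hj
        rwa [this]
      · have : 0 ≤ ∑ j : Fin (m + 1), (if p j then a j.castSucc - a j.succ else 0) := by
          refine Finset.sum_nonneg fun j _ => ?_
          split_ifs
          · exact sub_nonneg.2 (ha j.castSucc_lt_succ.le)
          · exact le_rfl
        linarith

theorem isClosed_tube {n : ℕ} (L : Submodule ℝ (E n)) {ρ : ℝ} (hρ : 0 ≤ ρ) :
    IsClosed (tube (sphereSection L) ρ) := by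
  have hcl : IsClosed (sphereSection L) :=
    L.closed_of_finiteDimensional.preimage continuous_subtype_val
  have : tube (sphereSection L) ρ = Metric.cthickening ρ (sphereSection L) := by
    rw [hcl.isCompact.cthickening_eq_biUnion_closedBall hρ]
    ext u
    simp only [tube, Set.mem_ofPred_eq, Set.mem_iUnion, Metric.mem_closedBall, exists_prop,
      Subtype.dist_eq, dist_comm (u : E n), dist_eq_norm]
  rw [this]
  exact Metric.isClosed_cthickening

variable {m : ℕ}

/-- The span of the vectors of an orthonormal basis with index larger than `k`. -/
def tailSpan (b : OrthonormalBasis (Fin (m + 1)) ℝ (E (m + 1))) (k : Fin (m + 1)) :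
    Submodule ℝ (E (m + 1)) :=
  Submodule.span ℝ (Set.range fun i : Finset.Ioi k => b i)

theorem finrank_tailSpan (b : OrthonormalBasis (Fin (m + 1)) ℝ (E (m + 1))) (k : Fin (m + 1)) :
    Module.finrank ℝ (tailSpan b k) = m - k := by
  have h : LinearIndependent ℝ fun i : Finset.Ioi k => b i :=
    b.orthonormal.linearIndependent.comp _ Subtype.val_injective
  rw [tailSpan, finrank_span_eq_card h, Fintype.card_coe, Fin.card_Ioi]
  omega

theorem mem_tailSpan (b : OrthonormalBasis (Fin (m + 1)) ℝ (E (m + 1))) {k i : Fin (m + 1)}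
    (h : k < i) : b i ∈ tailSpan b k :=
  Submodule.subset_span ⟨⟨i, Finset.mem_Ioi.2 h⟩, rfl⟩

theorem invariantSubspace_tailSpan {G : Subgroup (O (m + 1))}
    (b : OrthonormalBasis (Fin (m + 1)) ℝ (E (m + 1))) (k : Fin (m + 1))
    (h : ∀ g ∈ G, ∀ i j, i ≤ k → k < j → inner ℝ (b i) (g (b j)) = 0) :
    InvariantSubspace G (tailSpan b k) := by
  intro g hg x hx
  have : tailSpan b k ≤ (tailSpan b k).comap (g.toLinearEquiv : E (m + 1) →ₗ[ℝ] E (m + 1)) := by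
    refine Submodule.span_le.2 ?_
    rintro _ ⟨⟨j, hj⟩, rfl⟩
    change g (b j) ∈ tailSpan b k
    rw [← b.sum_repr' (g (b j))]
    refine Submodule.sum_mem _ fun i _ => ?_
    rcases le_or_gt i k with hik | hik
    · rw [h g hg i j hik (Finset.mem_Ioi.1 hj), zero_smul]
      exact Submodule.zero_mem _
    · exact Submodule.smul_mem _ _ (mem_tailSpan b hik)
  exact this hx

/-- Let `w` be the projection of `u` to the tail and `s = 1 - ‖w‖²`. Then `w / ‖w‖` is at squared
distance `2 - 2‖w‖ ≤ 2s` from `u`, so `s < δ² / 2` would put `u` in the tube. -/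
theorem sq_le_sum_of_notMem_tube (b : OrthonormalBasis (Fin (m + 1)) ℝ (E (m + 1)))
    (k : Fin (m + 1)) {δ : ℝ} (hδ : 0 < δ) (hδ1 : δ < 1) {u : Sph (m + 1)}
    (hu : u ∉ tube (sphereSection (tailSpan b k)) δ) :
    δ ^ 2 / 2 ≤ ∑ i ∈ Finset.Iic k, inner ℝ (b i) (u : E (m + 1)) ^ 2 := by
  by_contra! hs
  set c : Fin (m + 1) → ℝ := fun i => inner ℝ (b i) (u : E (m + 1)) with hc
  have hu1 : ‖(u : E (m + 1))‖ = 1 := norm_eq_of_mem_sphere u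
  have htot : ∑ i ∈ Finset.Iic k, c i ^ 2 + ∑ i ∈ Finset.Ioi k, c i ^ 2 = 1 := by
    have h1 : ∑ i, c i ^ 2 = 1 := by
      have := b.sum_sq_norm_inner_right (u : E (m + 1))
      simpa [hu1, hc] using this
    rw [← h1, ← Finset.sum_union]
    · congr 1
      ext i
      simp [le_or_gt]
    · rw [Finset.disjoint_left]
      intro i hi hi'
      exact absurd (Finset.mem_Iic.1 hi) (Finset.mem_Ioi.1 hi').not_ge
  set w : E (m + 1) := ∑ i ∈ Finset.Ioi k, c i • b i with hw
  have hwu : inner ℝ w (u : E (m + 1)) = ∑ i ∈ Finset.Ioi k, c i ^ 2 := by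
    rw [hw, sum_inner]
    exact Finset.sum_congr rfl fun i _ => by rw [real_inner_smul_left, sq]
  have hww : ‖w‖ ^ 2 = ∑ i ∈ Finset.Ioi k, c i ^ 2 := by
    rw [← real_inner_self_eq_norm_sq, hw, b.orthonormal.inner_sum]
    simp [sq]
  have hpos : 0 ≤ ∑ i ∈ Finset.Iic k, c i ^ 2 := Finset.sum_nonneg fun _ _ => sq_nonneg _
  have hw0 : 0 < ‖w‖ := by
    by_contra! h
    have : ‖w‖ = 0 := le_antisymm h (norm_nonneg _)
    rw [this] at hww
    nlinarith
  have hw1 : ‖w‖ ≤ 1 := by nlinarith [norm_nonneg w]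
  have hxn : ‖‖w‖⁻¹ • w‖ = 1 := by
    rw [norm_smul, norm_inv, norm_norm, inv_mul_cancel₀ hw0.ne']
  refine hu ⟨⟨‖w‖⁻¹ • w, by simpa using hxn⟩, ?_, ?_⟩
  · change ‖w‖⁻¹ • w ∈ tailSpan b k
    refine Submodule.smul_mem _ _ (Submodule.sum_mem _ fun i hi => Submodule.smul_mem _ _ ?_)
    exact mem_tailSpan b (Finset.mem_Ioi.1 hi)
  · change ‖‖w‖⁻¹ • w - (u : E (m + 1))‖ ≤ δ
    refine (pow_le_pow_iff_left₀ (norm_nonneg _) hδ.le two_ne_zero).1 ?_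
    rw [norm_sub_sq_real, hxn, hu1, real_inner_smul_left, hwu, ← hww]
    have : ‖w‖⁻¹ * ‖w‖ ^ 2 = ‖w‖ := by field_simp
    rw [this]
    nlinarith

/-- The integral of the logarithm of the support function of an ellipsoid with semi-axes `r` in the
directions `b`, when the measure is not concentrated near the spans of the short axes. -/
theorem le_integral_log_of_ellipsoid_le {δ τ : ℝ} (hδ : 0 < δ) (hδ1 : δ < 1)
    (μ : Measure (Sph (m + 1))) [IsProbabilityMeasure μ]
    (b : OrthonormalBasis (Fin (m + 1)) ℝ (E (m + 1))) {r : Fin (m + 1) → ℝ} (hr : Antitone r)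
    (hpos : ∀ i, 0 < r i)
    (htube : ∀ j : Fin m, r j.castSucc ≠ r j.succ →
      μ.real (tube (sphereSection (tailSpan b j.castSucc)) δ)
        ≤ (1 - τ) * (((m : ℝ) - j) / (m + 1)))
    {h : Sph (m + 1) → ℝ} (hint : Integrable (fun u => Real.log (h u)) μ) {c : ℝ} (hc : 0 < c)
    (hh : ∀ u : Sph (m + 1), c * √(∑ i, (r i * inner ℝ (b i) (u : E (m + 1))) ^ 2) ≤ h u) :
    Real.log (c * δ / √2) + τ * Real.log (r 0)
        + (1 - τ) * ((∑ i, Real.log (r i)) / (m + 1)) ≤ ∫ u, Real.log (h u) ∂μ := by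
  classical
  set a : Fin (m + 1) → ℝ := fun i => Real.log (r i) with ha
  have ha_anti : Antitone a := fun i j hij => Real.log_le_log (hpos j) (hr hij)
  set T : Fin m → Set (Sph (m + 1)) := fun j => tube (sphereSection (tailSpan b j.castSucc)) δ
  have hT : ∀ j, MeasurableSet (T j) := fun j => (isClosed_tube _ hδ.le).measurableSet
  have h2 : (0 : ℝ) < √2 := by positivity
  -- Each tube containing `u` costs one drop of `log r`. At the first missed tube `k`, the
  -- coordinates up to `k` carry mass at least `δ² / 2` and have semi-axes at least `r k`.
  have hpt : ∀ u, Real.log (c * δ / √2) + a 0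
      - ∑ j, (T j).indicator (fun _ => a j.castSucc - a j.succ) u ≤ Real.log (h u) := by
    intro u
    obtain ⟨k, hk, hle⟩ := exists_le_of_antitone a ha_anti fun j => u ∈ T j
    simp only [Set.indicator_apply]
    refine (show _ ≤ Real.log (c * δ / √2) + a k by linarith).trans ?_
    rw [ha, ← Real.log_mul (by positivity) (hpos k).ne']
    have hrk := hpos k
    refine Real.log_le_log (by positivity) (le_trans ?_ (hh u))
    have hsum : δ ^ 2 / 2 ≤ ∑ i ∈ Finset.Iic k, inner ℝ (b i) (u : E (m + 1)) ^ 2 := by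
      rcases Fin.eq_castSucc_or_eq_last k with ⟨j, rfl⟩ | rfl
      · exact sq_le_sum_of_notMem_tube b _ hδ hδ1 (hk j rfl)
      · have : Finset.Iic (Fin.last m) = Finset.univ := by
          ext i; simp [Fin.le_last]
        have h1 := b.sum_sq_norm_inner_right (u : E (m + 1))
        rw [norm_eq_of_mem_sphere u] at h1
        simp only [Real.norm_eq_abs, sq_abs] at h1
        rw [this, h1]
        nlinarith
    have hsum' : (r k * (δ / √2)) ^ 2 ≤ ∑ i, (r i * inner ℝ (b i) (u : E (m + 1))) ^ 2 := by
      calc (r k * (δ / √2)) ^ 2 = r k ^ 2 * (δ ^ 2 / 2) := by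
            rw [mul_pow, div_pow, Real.sq_sqrt zero_le_two]
        _ ≤ r k ^ 2 * ∑ i ∈ Finset.Iic k, inner ℝ (b i) (u : E (m + 1)) ^ 2 := by gcongr
        _ ≤ ∑ i ∈ Finset.Iic k, (r i * inner ℝ (b i) (u : E (m + 1))) ^ 2 := by
            rw [Finset.mul_sum]
            refine Finset.sum_le_sum fun i hi => ?_
            rw [mul_pow]
            gcongr
            exact hr (Finset.mem_Iic.1 hi)
        _ ≤ _ := Finset.sum_le_sum_of_subset_of_nonneg (Finset.subset_univ _)
            fun _ _ _ => sq_nonneg _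
    calc c * δ / √2 * r k = c * (r k * (δ / √2)) := by ring
      _ ≤ _ := by
        gcongr
        exact Real.le_sqrt_of_sq_le hsum'
  have hindint : ∀ j, Integrable ((T j).indicator fun _ => a j.castSucc - a j.succ) μ := fun j =>
    (integrable_const _).indicator (hT j)
  have hsumint : Integrable
      (fun u => ∑ j, (T j).indicator (fun _ => a j.castSucc - a j.succ) u) μ :=
    integrable_finsetSum _ fun j _ => hindint j
  have hmono := integral_mono ((integrable_const _).sub hsumint) hint hpt
  refine le_trans ?_ hmono
  simp only [Pi.sub_apply]
  rw [integral_sub (integrable_const _) hsumint, integral_finsetSum _ fun j _ => hindint j]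
  simp only [integral_const, probReal_univ, integral_indicator_const _ (hT _),
    smul_eq_mul]
  have hle : ∑ j, μ.real (T j) * (a j.castSucc - a j.succ)
      ≤ ∑ j : Fin m, (1 - τ) / (m + 1) * (((m : ℝ) - j) * (a j.castSucc - a j.succ)) := by
    refine Finset.sum_le_sum fun j _ => ?_
    -- Where the semi-axes agree there is no tube bound, but the drop it would multiply is `0`.
    by_cases hj : r j.castSucc = r j.succ
    · have : a j.castSucc - a j.succ = 0 := by rw [ha]; simp [hj]
      simp [this]
    · refine (mul_le_mul_of_nonneg_right (htube j hj)
        (sub_nonneg.2 (ha_anti j.castSucc_lt_succ.le))).trans_eq ?_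
      ring
  rw [← Finset.mul_sum, sum_mul_sub_succ] at hle
  have hm : (m : ℝ) + 1 ≠ 0 := by positivity
  have heq : (1 - τ) / ((m : ℝ) + 1) * ((m + 1) * a 0 - ∑ i, a i)
      = (1 - τ) * a 0 - (1 - τ) * ((∑ i, a i) / (m + 1)) := by
    field_simp
  rw [heq] at hle
  change _ + τ * a 0 + (1 - τ) * ((∑ i, a i) / (m + 1)) ≤ _
  linarith

/-- A convex set without interior lies in its own frontier, which is null. -/
theorem interior_nonempty_of_volume_ne_zero {n : ℕ} {C : Set (E n)} (hconv : Convex ℝ C)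
    (h : volume C ≠ 0) : (interior C).Nonempty := by
  by_contra hne
  rw [Set.not_nonempty_iff_eq_empty] at hne
  refine h (measure_mono_null ?_ (hconv.addHaar_frontier volume))
  rw [frontier, hne, Set.sdiff_empty]
  exact subset_closure

/-- Metric data of an invariant convex body `C` of volume one: a system of semi-axes `r`,
comparable to the circumradius and the inradius of `C`, for which the logarithmic integral of the
support function of `C` is bounded from below. -/
theorem exists_semiaxes {δ τ : ℝ} (hδ : δ ∈ Set.Ioo (0 : ℝ) (1 / 2)) {G : Subgroup (O (m + 1))}
    (hfix : NoNonzeroFixedPoint G) (μ : Measure (Sph (m + 1))) [IsProbabilityMeasure μ]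
    (htube : ∀ (i : ℕ) (L : Submodule ℝ (E (m + 1))), 1 ≤ i → i ≤ m → Module.finrank ℝ L = i →
      InvariantSubspace G L →
        μ.real (tube (sphereSection L) δ) < (1 - τ) * ((i : ℝ) / ((m : ℝ) + 1)))
    (C : ConvexBody (E (m + 1))) (hC : InvariantSet G (C : Set (E (m + 1))))
    (hvol : volume (C : Set (E (m + 1))) = 1) :
    ∃ r : Fin (m + 1) → ℝ, Antitone r ∧ (∀ i, 0 < r i) ∧
      1 ≤ ∏ i, (2 * (√((m : ℝ) + 1) * r i)) ∧
      circumradius (C : Set (E (m + 1))) ≤ √((m : ℝ) + 1) * r 0 ∧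
      r 0 / √((m : ℝ) + 1) ≤ circumradius (C : Set (E (m + 1))) ∧
      r (Fin.last m) / √((m : ℝ) + 1) ≤ inradius (C : Set (E (m + 1))) ∧
      Integrable
        (fun u : Sph (m + 1) => Real.log (supportFunction (C : Set (E (m + 1))) u)) μ ∧
      Real.log ((√((m : ℝ) + 1))⁻¹ * δ / √2) + τ * Real.log (r 0)
        + (1 - τ) * ((∑ i, Real.log (r i)) / (m + 1))
        ≤ ∫ u : Sph (m + 1), Real.log (supportFunction (C : Set (E (m + 1))) u) ∂μ := by
  have hint := interior_nonempty_of_volume_ne_zero C.convex (by rw [hvol]; exact one_ne_zero)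
  obtain ⟨b, r, hr, hpos, hinv, hup, hlow⟩ :=
    exists_john_basis m.succ_pos hfix C.isCompact hint hC
  push_cast at hup hlow
  set s := √((m : ℝ) + 1) with hs
  have hs0 : 0 < s := by positivity
  have hs2 : s ^ 2 = m + 1 := Real.sq_sqrt (by positivity)
  have hb1 : ∀ i, ‖b i‖ = 1 := b.orthonormal.1
  have hsum : ∀ u, ∑ i, inner ℝ (b i) u ^ 2 = ‖u‖ ^ 2 := fun u => by
    simpa using b.sum_sq_norm_inner_right u
  have hlast : ∀ u, r (Fin.last m) / s * ‖u‖ ≤ supportFunction (C : Set (E (m + 1))) u := by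
    intro u
    have h1 : r (Fin.last m) * ‖u‖ ≤ √(∑ i, (r i * inner ℝ (b i) u) ^ 2) := by
      refine Real.le_sqrt_of_sq_le ?_
      rw [mul_pow, ← hsum, Finset.mul_sum]
      refine Finset.sum_le_sum fun i _ => ?_
      rw [mul_pow]
      have := hpos (Fin.last m)
      gcongr
      exact hr (Fin.le_last i)
    rw [div_mul_eq_mul_div, div_le_iff₀ hs0, mul_comm _ s]
    exact h1.trans (hlow u)
  have hball := closedBall_subset_of_le_supportFunction C.convex C.isClosed C.nonempty hlast
  have hRball : (C : Set (E (m + 1))) ⊆ Metric.closedBall 0 (s * r 0) := by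
    intro x hx
    rw [mem_closedBall_zero_iff]
    have h1 := hup x hx x
    have h2 : ∑ i, (r i * inner ℝ (b i) x) ^ 2 ≤ r 0 ^ 2 * ‖x‖ ^ 2 := by
      rw [← hsum, Finset.mul_sum]
      refine Finset.sum_le_sum fun i _ => ?_
      rw [mul_pow]
      have := hpos i
      gcongr
      exact hr (Fin.zero_le i)
    rw [real_inner_self_eq_norm_sq] at h1
    have h3 : (‖x‖ ^ 2) * ‖x‖ ^ 2 ≤ (s * r 0) ^ 2 * ‖x‖ ^ 2 := by
      rw [mul_pow, hs2]
      calc _ = (‖x‖ ^ 2) ^ 2 := by ring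
        _ ≤ _ := h1
        _ ≤ ((m : ℝ) + 1) * (r 0 ^ 2 * ‖x‖ ^ 2) := by gcongr
        _ = _ := by ring
    have hnn : 0 ≤ s * r 0 := (mul_pos hs0 (hpos 0)).le
    rcases eq_or_ne x 0 with rfl | hx0
    · simpa using hnn
    · have := le_of_mul_le_mul_right h3 (by positivity)
      exact (pow_le_pow_iff_left₀ (norm_nonneg _) hnn two_ne_zero).1 this
  -- The enclosing ball may have any centre, so the width `h_C(b 0) + h_C(-b 0) ≤ 2R` is used: the
  -- centre cancels.
  have hR0 : r 0 / s ≤ circumradius (C : Set (E (m + 1))) := by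
    have hsf : ∀ y : E (m + 1), (∀ i, inner ℝ (b i) y ^ 2 = if i = 0 then 1 else 0) →
        r 0 / s ≤ supportFunction (C : Set (E (m + 1))) y := by
      intro y hy
      rw [div_le_iff₀ hs0, mul_comm _ s]
      refine le_trans (Real.le_sqrt_of_sq_le ?_) (hlow y)
      simp [mul_pow, hy]
    have h1 := hsf (b 0) fun i => by rw [b.inner_eq_ite]; split_ifs <;> simp
    have h2 := hsf (-b 0) fun i => by rw [inner_neg_right, b.inner_eq_ite]; split_ifs <;> simp
    refine le_csInf ⟨s * r 0, (mul_pos hs0 (hpos 0)).le, 0, hRball⟩ ?_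
    rintro R ⟨-, x, hx⟩
    have hle : ∀ y : E (m + 1), ‖y‖ = 1 →
        supportFunction (C : Set (E (m + 1))) y ≤ inner ℝ y x + R := by
      intro y hy
      refine csSup_le (C.nonempty.image _) ?_
      rintro _ ⟨z, hz, rfl⟩
      have h3 : inner ℝ y (z - x) ≤ R := by
        refine (real_inner_le_norm _ _).trans ?_
        rw [hy, one_mul, ← dist_eq_norm]
        exact hx hz
      rw [inner_sub_right] at h3
      change inner ℝ y z ≤ _
      linarith
    have h3 := hle (b 0) (hb1 0)
    have h4 := hle (-b 0) (by rw [norm_neg, hb1])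
    rw [inner_neg_left] at h4
    linarith
  have hvolr : 1 ≤ ∏ i, (2 * (s * r i)) := by
    have hsub : (C : Set (E (m + 1))) ⊆ {x | ∀ i, |inner ℝ (b i) x| ≤ s * r i} := by
      intro x hx i
      have h1 := hup x hx (b i)
      have h2 : ∑ j, (r j * inner ℝ (b j) (b i)) ^ 2 = r i ^ 2 := by
        simp [b.inner_eq_ite]
      rw [h2, ← hs2, ← mul_pow] at h1
      exact abs_le_of_sq_le_sq h1 (mul_pos hs0 (hpos i)).le
    have h3 := measure_mono (μ := volume) hsub
    rw [hvol, volume_box, ← ENNReal.ofReal_prod_of_nonneg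
      fun i _ => (mul_pos two_pos (mul_pos hs0 (hpos i))).le] at h3
    exact ENNReal.one_le_ofReal.1 h3
  have hsfpos : ∀ u : Sph (m + 1), 0 < supportFunction (C : Set (E (m + 1))) u := by
    intro u
    refine lt_of_lt_of_le ?_ (hlast u)
    rw [norm_eq_of_mem_sphere u, mul_one]
    exact div_pos (hpos _) hs0
  have hinteg := integrable_log_supportFunction C.isCompact hsfpos μ
  refine ⟨r, hr, hpos, hvolr, circumradius_le (mul_pos hs0 (hpos 0)).le hRball, hR0,
    le_inradius C.isBounded (div_pos (hpos _) hs0).le (hb1 0) hball, hinteg, ?_⟩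
  refine le_integral_log_of_ellipsoid_le hδ.1 (by linarith [hδ.2]) μ b hr hpos ?_ hinteg
    (inv_pos.2 hs0) fun u => ?_
  · intro j hj
    -- The strict drop makes every semi-axis up to `j` differ from every later one, so `G` does not
    -- mix the two groups of axes.
    have hlt : r j.succ < r j.castSucc := lt_of_le_of_ne (hr j.castSucc_lt_succ.le) hj.symm
    have h1 := htube (m - j) (tailSpan b j.castSucc) (by omega) (by omega)
      (by simp [finrank_tailSpan]) (invariantSubspace_tailSpan b _ fun g hg i k hi hk => by
        refine hinv g hg i k (ne_of_gt ?_)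
        exact (hr (Fin.castSucc_lt_iff_succ_le.1 hk)).trans_lt (hlt.trans_le (hr hi)))
    rw [Nat.cast_sub j.is_le'] at h1
    exact h1.le
  · rw [inv_mul_le_iff₀ hs0]
    exact hlow u

end CoxeterLog

/-! ### The two estimates, in logarithmic form -/

theorem mainTheorem6 (n : ℕ) (hn : 2 ≤ n) (δ τ : ℝ)
    (hδ : δ ∈ Set.Ioo (0 : ℝ) (1 / 2)) (hτ : τ ∈ Set.Ioo (0 : ℝ) (1 / 2))
    (G : Subgroup (O n)) (hG : IsCoxeterReflectionGroup G) (hred : ActsReducibly G)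
    (hfix : NoNonzeroFixedPoint G)
    (μ : Measure (Sph n)) [IsProbabilityMeasure μ] (hμ : InvariantMeasure G μ)
    (htube : ∀ (i : ℕ) (L : Submodule ℝ (E n)), 1 ≤ i → i ≤ n - 1 → Module.finrank ℝ L = i →
      InvariantSubspace G L →
        μ.real (tube (sphereSection L) δ) < (1 - τ) * ((i : ℝ) / (n : ℝ)))
    (C : ConvexBody (E n)) (hC : InvariantSet G (C : Set (E n)))
    (hvol : volume (C : Set (E n)) = 1) :
    (Integrable (fun u : Sph n => Real.log (supportFunction (C : Set (E n)) (u : E n))) μ ∧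
      Real.log (circumradius (C : Set (E n)) ^ τ * δ / (n : ℝ) ^ 5)
        ≤ ∫ u : Sph n, Real.log (supportFunction (C : Set (E n)) (u : E n)) ∂μ) ∧
    ((∫ u : Sph n, Real.log (supportFunction (C : Set (E n)) (u : E n)) ∂μ
        ≤ ∫ u : Sph n, Real.log (supportFunction (unitVolumeBall n) (u : E n)) ∂μ) →
      circumradius (C : Set (E n)) < ((n : ℝ) ^ 6 / δ) ^ (1 / τ) ∧
      (n : ℝ) ^ ((n : ℝ) / 2) / (5 : ℝ) ^ n * (δ / (n : ℝ) ^ 6) ^ (((n : ℝ) - 1) / τ)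
        < inradius (C : Set (E n))) := by
  obtain ⟨m, rfl⟩ : ∃ m, n = m + 1 := ⟨n - 1, by omega⟩
  have hball := integral_log_supportFunction_unitVolumeBall (n := m + 1) (by omega) μ
  obtain ⟨hδ0, hδ1⟩ := hδ
  obtain ⟨hτ0, hτ1⟩ := hτ
  push_cast at htube hball ⊢
  obtain ⟨r, hr, hpos, hprod, hR, hR', hin, hint, hI⟩ :=
    exists_semiaxes ⟨hδ0, hδ1⟩ hfix μ htube C hC hvol
  set R := circumradius (C : Set (E (m + 1)))
  set ρ := inradius (C : Set (E (m + 1)))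
  set I := ∫ u : Sph (m + 1), Real.log (supportFunction (C : Set (E (m + 1))) u) ∂μ
  set N : ℝ := (m : ℝ) + 1 with hN
  have hm1 : (1 : ℝ) ≤ m := by exact_mod_cast (by omega : 1 ≤ m)
  have hN2 : 2 ≤ N := by linarith
  have hN0 : 0 < N := by linarith
  have hs0 : 0 < √N := Real.sqrt_pos.2 hN0
  have hr0 := hpos 0
  have hrl := hpos (Fin.last m)
  have hR0 : 0 < R := (div_pos hr0 hs0).trans_le hR'
  have hρ0 : 0 < ρ := (div_pos hrl hs0).trans_le hin
  have hlog2 : 0 < Real.log 2 := Real.log_pos one_lt_two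
  have hlogN : Real.log 2 ≤ Real.log N := Real.log_le_log two_pos hN2
  have hlogs : Real.log √N = Real.log N / 2 := Real.log_sqrt hN0.le
  have hlogR : Real.log R ≤ Real.log N / 2 + Real.log (r 0) := by
    rw [← hlogs, ← Real.log_mul hs0.ne' hr0.ne']
    exact Real.log_le_log hR0 hR
  have hlogR' : Real.log (r 0) - Real.log N / 2 ≤ Real.log R := by
    rw [← hlogs, ← Real.log_div hr0.ne' hs0.ne']
    exact Real.log_le_log (div_pos hr0 hs0) hR'
  have hlogρ : Real.log (r (Fin.last m)) - Real.log N / 2 ≤ Real.log ρ := by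
    rw [← hlogs, ← Real.log_div hrl.ne' hs0.ne']
    exact Real.log_le_log (div_pos hrl hs0) hin
  have hsum : -(N * (Real.log 2 + Real.log N / 2)) ≤ ∑ i, Real.log (r i) := by
    have h1 := Real.log_nonneg hprod
    rw [Real.log_prod fun i _ => (mul_pos two_pos (mul_pos hs0 (hpos i))).ne'] at h1
    have h2 : ∀ i, Real.log (2 * (√N * r i))
        = (Real.log 2 + Real.log N / 2) + Real.log (r i) := fun i => by
      rw [Real.log_mul two_ne_zero (mul_pos hs0 (hpos i)).ne',
        Real.log_mul hs0.ne' (hpos i).ne', hlogs, add_assoc]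
    simp only [h2, Finset.sum_add_distrib, Finset.sum_const, Finset.card_univ, Fintype.card_fin,
      nsmul_eq_mul] at h1
    push_cast at h1
    linarith
  have hlogc : Real.log ((√N)⁻¹ * δ / √2) = Real.log δ - Real.log N / 2 - Real.log 2 / 2 := by
    rw [Real.log_div (by positivity) (by positivity), Real.log_mul (by positivity) hδ0.ne',
      Real.log_inv, hlogs, Real.log_sqrt zero_le_two]
    ring
  -- The total loss is `log N + (3/2 - τ) log 2`, at most `5/2 log N` because `N ≥ 2`.
  have hmain : Real.log δ + τ * Real.log R - 5 / 2 * Real.log N ≤ I := by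
    have h1 : -(Real.log 2 + Real.log N / 2) ≤ (∑ i, Real.log (r i)) / N := by
      rw [le_div_iff₀ hN0]
      linarith
    have h2 := mul_le_mul_of_nonneg_left h1 (by linarith : 0 ≤ 1 - τ)
    have h3 := mul_le_mul_of_nonneg_left hlogR hτ0.le
    have h4 : 0 ≤ τ * Real.log 2 := by positivity
    rw [hlogc] at hI
    linarith
  refine ⟨⟨hint, ?_⟩, fun hle => ?_⟩
  · rw [Real.log_div (by positivity) (by positivity), Real.log_mul (by positivity) hδ0.ne',
      Real.log_rpow hR0, Real.log_pow]
    push_cast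
    linarith
  · have h1 : τ * Real.log R ≤ 7 / 2 * Real.log N - Real.log δ := by linarith
    -- Since `τ < 1/2`, the spare `5/2 log N` between `7/2` and `6` becomes `5 log N` after division
    -- by `τ`; it pays for the factor `n^(n/2)` in the inradius bound.
    have h2 : Real.log R + 5 * Real.log N ≤ (6 * Real.log N - Real.log δ) / τ := by
      rw [le_div_iff₀ hτ0]
      have := mul_le_mul_of_nonneg_right hτ1.le (hlog2.le.trans hlogN)
      linarith
    refine ⟨?_, ?_⟩
    · refine (Real.log_lt_log_iff hR0 (by positivity)).1 ?_
      rw [Real.log_rpow (by positivity), Real.log_div (by positivity) hδ0.ne', Real.log_pow]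
      push_cast
      rw [one_div_mul_eq_div]
      linarith
    · refine (Real.log_lt_log_iff (by positivity) hρ0).1 ?_
      rw [Real.log_mul (by positivity) (by positivity), Real.log_div (by positivity) (by positivity),
        Real.log_rpow hN0, Real.log_pow, Real.log_rpow (by positivity),
        Real.log_div hδ0.ne' (by positivity), Real.log_pow]
      push_cast
      have h3 : (N - 1) / τ * (Real.log δ - 6 * Real.log N)
          = -(m * ((6 * Real.log N - Real.log δ) / τ)) := by
        rw [hN]; ring
      -- The other `m` semi-axes are at most `r 0`, so the lower bound on the product passes to the
      -- shortest one.
      have h4 : ∑ i, Real.log (r i) ≤ m * Real.log (r 0) + Real.log (r (Fin.last m)) := by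
        rw [Fin.sum_univ_castSucc]
        refine add_le_add ((Finset.sum_le_card_nsmul _ _ (Real.log (r 0)) fun i _ => ?_).trans_eq
          (by simp)) le_rfl
        exact Real.log_le_log (hpos _) (hr (Fin.zero_le _))
      have h5 := mul_le_mul_of_nonneg_left hlogR' (by linarith : (0 : ℝ) ≤ m)
      have h6 := mul_le_mul_of_nonneg_left h2 (by linarith : (0 : ℝ) ≤ m)
      have h7 : Real.log 2 < Real.log 5 := Real.log_lt_log two_pos (by norm_num)
      have h8 := mul_lt_mul_of_pos_left h7 hN0
      have h9 : Real.log N ≤ m * Real.log N :=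
        le_mul_of_one_le_left (hlog2.le.trans hlogN) hm1
      rw [h3]
      change N / 2 * Real.log N - N * Real.log 5 + _ < _
      have h10 : N * Real.log N = m * Real.log N + Real.log N := by rw [hN]; ring
      linarith
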